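/- Let $J=\begin{pmatrix}0&0&0&1\\0&0&1&0\\0&-1&0&0\\-1&0&0&0\end{pmatrix}$ and, for a commutative ring $R$, let $$\mathrm{GSp}_4(R)=\{\gamma\in \mathrm{GL}_4(R) : \gamma^{t}J\gamma=\nu J \text{ for some } \nu\in R^\times\}.$$ View $G=\mathrm{GSp}_4\times\mathrm{GSp}_4$ as an affine algebraic group over $\overline{\mathbb Q}$, with coordinate ring $$\mathcal O(G)=\frac{\overline{\mathbb Q}\big[\{a_{ij},a'_{ij} : 1\le i,j\le 4\},\,t,\,t'\big]}{\Big\langle \sum_{j,k} t\,a_{ji}J_{jk}a_{kl}-J_{il},\ \ \sum_{j,k} t'\,a'_{ji}J_{jk}a'_{kl}-J_{il}\ :\ 1\le i<l\le 4\Big\rangle}.$$ Then $\mathcal O(G)$ is a unique factorisation domain. -/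

import Mathlib

open Matrix

namespace GSpFour

/-- The alternating `4 × 4` matrix `J` with entries in `R`. -/
def J (R : Type*) [CommRing R] : Matrix (Fin 4) (Fin 4) R :=
  !![0, 0, 0, 1;
     0, 0, 1, 0;
     0, -1, 0, 0;
     -1, 0, 0, 0]

theorem J_map {R S : Type*} [CommRing R] [CommRing S] (f : R →+* S) : (J R).map f = J S := by
  ext i j
  fin_cases i <;> fin_cases j <;> simp [J]

theorem J_transpose (R : Type*) [CommRing R] : (J R)ᵀ = -J R := by
  ext i j
  fin_cases i <;> fin_cases j <;> simp [J]

theorem J_det (R : Type*) [CommRing R] : (J R).det = 1 := by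
  simp [J, det_succ_row_zero, Fin.sum_univ_succ, Fin.succAbove]
  norm_num

/-- The group `GSp₄(R)` of all `γ ∈ GL₄(R)` such that `γᵀ J γ = ν J` for some unit `ν` of `R`. -/
def GSp4 (R : Type*) [CommRing R] : Subgroup (GL (Fin 4) R) where
  carrier := {γ | ∃ ν : Rˣ, (γ : Matrix (Fin 4) (Fin 4) R)ᵀ * J R *
    (γ : Matrix (Fin 4) (Fin 4) R) = (ν : R) • J R}
  one_mem' := ⟨1, by simp⟩
  mul_mem' := by
    rintro γ δ ⟨ν, hν⟩ ⟨μ, hμ⟩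
    refine ⟨ν * μ, ?_⟩
    have : ((γ * δ : GL (Fin 4) R) : Matrix (Fin 4) (Fin 4) R)ᵀ * J R *
        ((γ * δ : GL (Fin 4) R) : Matrix (Fin 4) (Fin 4) R) =
        (δ : Matrix (Fin 4) (Fin 4) R)ᵀ * ((γ : Matrix (Fin 4) (Fin 4) R)ᵀ * J R *
          (γ : Matrix (Fin 4) (Fin 4) R)) * (δ : Matrix (Fin 4) (Fin 4) R) := by
      simp only [Units.val_mul, transpose_mul, Matrix.mul_assoc]
    rw [this, hν, Matrix.mul_smul, Matrix.smul_mul, hμ, smul_smul, Units.val_mul]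
  inv_mem' := by
    rintro γ ⟨ν, hν⟩
    refine ⟨ν⁻¹, ?_⟩
    have h1 : (γ : Matrix (Fin 4) (Fin 4) R) * ((γ⁻¹ : GL (Fin 4) R) : Matrix _ _ R) = 1 := by
      rw [← Units.val_mul, mul_inv_cancel, Units.val_one]
    have h2 : ((γ⁻¹ : GL (Fin 4) R) : Matrix (Fin 4) (Fin 4) R)ᵀ *
        (γ : Matrix (Fin 4) (Fin 4) R)ᵀ = 1 := by
      rw [← transpose_mul, h1, transpose_one]
    have h3 : (ν : R) • (((γ⁻¹ : GL (Fin 4) R) : Matrix (Fin 4) (Fin 4) R)ᵀ * J R *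
        ((γ⁻¹ : GL (Fin 4) R) : Matrix (Fin 4) (Fin 4) R)) = J R := by
      rw [← Matrix.smul_mul, ← Matrix.mul_smul, ← hν]
      rw [Matrix.mul_assoc, Matrix.mul_assoc, h1, Matrix.mul_one, ← Matrix.mul_assoc, h2,
        Matrix.one_mul]
    calc _ = (((ν⁻¹ : Rˣ) : R) * (ν : R)) •
          (((γ⁻¹ : GL (Fin 4) R) : Matrix (Fin 4) (Fin 4) R)ᵀ * J R *
        ((γ⁻¹ : GL (Fin 4) R) : Matrix (Fin 4) (Fin 4) R)) := by simp
      _ = _ := by rw [← smul_smul, h3]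

/-- The coordinates on `GSp₄ × GSp₄`: for each of the two factors `s`, the matrix entries
`a s i j` and one further coordinate `t s`, the inverse of the similitude. -/
inductive Coord : Type
  | a (s : Fin 2) (i j : Fin 4)
  | t (s : Fin 2)

/-- The generic `4 × 4` matrix of the factor `s`. -/
noncomputable def genericMatrix (K : Type*) [CommRing K] (s : Fin 2) :
    Matrix (Fin 4) (Fin 4) (MvPolynomial Coord K) :=
  Matrix.of fun i j => MvPolynomial.X (Coord.a s i j)

/-- The `(i, l)` entry of `t Aᵀ J A - J`, where `A` is the generic matrix of the factor `s`. -/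
noncomputable def relation (K : Type*) [CommRing K] (s : Fin 2) (i l : Fin 4) :
    MvPolynomial Coord K :=
  ((MvPolynomial.X (Coord.t s) : MvPolynomial Coord K) • ((genericMatrix K s)ᵀ *
    J (MvPolynomial Coord K) * genericMatrix K s) - J (MvPolynomial Coord K)) i l

/-- The ideal generated by the entries of `t Aᵀ J A - J` above the diagonal, for both factors. -/
noncomputable def relationIdeal (K : Type*) [CommRing K] : Ideal (MvPolynomial Coord K) :=
  Ideal.span {f | ∃ (s : Fin 2) (i l : Fin 4), i < l ∧ f = relation K s i l}

/-- The coordinate ring `𝒪(GSp₄ × GSp₄)` of the affine algebraic group `GSp₄ × GSp₄` over `K`. -/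
abbrev CoordinateRing (K : Type*) [CommRing K] : Type _ :=
  MvPolynomial Coord K ⧸ relationIdeal K

section Points

variable {K : Type*} [CommRing K] {R : Type*} [CommRing R] [Algebra K R]

/-- The matrix of the factor `s` at an `R`-valued point of the ambient affine space. -/
def evalMatrix (x : Coord → R) (s : Fin 2) : Matrix (Fin 4) (Fin 4) R :=
  Matrix.of fun i j => x (Coord.a s i j)

theorem aeval_relation (x : Coord → R) (s : Fin 2) (i l : Fin 4) :
    MvPolynomial.aeval x (relation K s i l) =
      (x (Coord.t s) • ((evalMatrix x s)ᵀ * J R * evalMatrix x s) - J R) i l := by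
  have hJ (i l : Fin 4) : MvPolynomial.aeval x (J (MvPolynomial Coord K) i l) = J R i l :=
    congrFun (congrFun (J_map (MvPolynomial.aeval x : MvPolynomial Coord K →ₐ[K] R).toRingHom) i) l
  simp [relation, Matrix.mul_apply, genericMatrix, evalMatrix, hJ]

/-- The entries above the diagonal determine the whole matrix identity. -/
theorem upper_iff (A : Matrix (Fin 4) (Fin 4) R) (t : R) :
    (∀ i l : Fin 4, i < l → (t • (Aᵀ * J R * A) - J R) i l = 0) ↔ t • (Aᵀ * J R * A) = J R := by
  constructor
  · intro h
    have hdiag (i : Fin 4) : (t • (Aᵀ * J R * A) - J R) i i = 0 := by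
      fin_cases i <;>
        simp [Matrix.mul_apply, Fin.sum_univ_succ, J] <;> ring
    have hskew : (t • (Aᵀ * J R * A) - J R)ᵀ = -(t • (Aᵀ * J R * A) - J R) := by
      simp only [transpose_sub, transpose_smul, transpose_mul, transpose_transpose, J_transpose,
        Matrix.neg_mul, Matrix.mul_neg, smul_neg, ← Matrix.mul_assoc, neg_sub]
      abel
    rw [← sub_eq_zero]
    ext i l
    rcases lt_trichotomy i l with hil | rfl | hil
    · exact h i l hil
    · exact hdiag i
    · have h1 := congrFun (congrFun hskew l) i
      rw [transpose_apply, Matrix.neg_apply, h l i hil, neg_zero] at h1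
      exact h1
  · intro h i l _
    rw [h, sub_self, Matrix.zero_apply]

/-- A point satisfying the matrix identity gives an element of `GSp₄(R)`. -/
theorem isUnit_of_eq {A : Matrix (Fin 4) (Fin 4) R} {t : R} (h : t • (Aᵀ * J R * A) = J R) :
    IsUnit t ∧ IsUnit A.det := by
  have hd := congrArg Matrix.det h
  simp only [det_smul, det_mul, det_transpose, J_det, Fintype.card_fin] at hd
  exact ⟨IsUnit.of_mul_eq_one (t ^ 3 * (A.det * 1 * A.det)) (by linear_combination hd),
    IsUnit.of_mul_eq_one (t ^ 4 * A.det) (by linear_combination hd)⟩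

/-- The similitude, and hence its inverse `t`, is determined by the matrix. -/
theorem similitude_unique {A : Matrix (Fin 4) (Fin 4) R} {t u : R}
    (ht : t • (Aᵀ * J R * A) = J R) (hu : u • (Aᵀ * J R * A) = J R) : t = u := by
  obtain ⟨w, rfl⟩ := (isUnit_of_eq ht).1
  have h1 : Aᵀ * J R * A = ((w⁻¹ : Rˣ) : R) • J R := by
    conv_rhs => rw [← ht, smul_smul, Units.inv_mul, one_smul]
  have h2 := congrFun (congrFun hu 0) 3
  rw [h1] at h2
  simp only [J, smul_smul, Matrix.smul_apply] at h2
  have h3 : u * ((w⁻¹ : Rˣ) : R) = 1 := by simpa using h2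
  calc (w : R) = (u * ((w⁻¹ : Rˣ) : R)) * w := by rw [h3, one_mul]
    _ = u := by rw [mul_assoc, Units.inv_mul, mul_one]

/-- The `R`-valued point of the ambient affine space given by a `K`-algebra homomorphism. -/
noncomputable def toPoint (φ : CoordinateRing K →ₐ[K] R) : Coord → R :=
  fun c => φ (Ideal.Quotient.mk _ (MvPolynomial.X c))

theorem toPoint_spec (φ : CoordinateRing K →ₐ[K] R) (s : Fin 2) :
    toPoint φ (Coord.t s) •
      ((evalMatrix (toPoint φ) s)ᵀ * J R * evalMatrix (toPoint φ) s) = J R := by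
  rw [← upper_iff]
  intro i l hil
  rw [← aeval_relation (K := K)]
  have h : MvPolynomial.aeval (toPoint φ) =
      φ.comp (Ideal.Quotient.mkₐ K (relationIdeal K)) := by
    ext c
    simp [toPoint]
  have hmem : relation K s i l ∈ relationIdeal K := Ideal.subset_span ⟨s, i, l, hil, rfl⟩
  rw [h, AlgHom.comp_apply, Ideal.Quotient.mkₐ_eq_mk, Ideal.Quotient.eq_zero_iff_mem.mpr hmem,
    map_zero]

/-- The element of `GSp₄(R)` on the factor `s` that is given by a homomorphism from the
coordinate ring to `R`: its entries are the images of the coordinates `a s i j`. -/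
noncomputable def component (s : Fin 2) (φ : CoordinateRing K →ₐ[K] R) : GSp4 R :=
  ⟨((Matrix.isUnit_iff_isUnit_det _).mpr (isUnit_of_eq (toPoint_spec φ s)).2).unit, by
    refine ⟨(isUnit_of_eq (toPoint_spec φ s)).1.unit⁻¹, ?_⟩
    rw [IsUnit.unit_spec]
    conv_rhs => rw [← toPoint_spec φ s, smul_smul, IsUnit.val_inv_mul, one_smul]⟩

@[simp]
theorem component_apply (s : Fin 2) (φ : CoordinateRing K →ₐ[K] R) (i j : Fin 4) :
    ((component s φ : GL (Fin 4) R) : Matrix (Fin 4) (Fin 4) R) i j =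
      φ (Ideal.Quotient.mk _ (MvPolynomial.X (Coord.a s i j))) := rfl

/-- `CoordinateRing K` represents the functor `R ↦ GSp₄(R) × GSp₄(R)` on `K`-algebras. By
`component_apply` the bijection is natural in `R`. -/
theorem component_bijective :
    Function.Bijective (fun φ : CoordinateRing K →ₐ[K] R => (component 0 φ, component 1 φ)) := by
  constructor
  · intro φ ψ h
    have hA (s : Fin 2) : evalMatrix (toPoint φ) s = evalMatrix (toPoint ψ) s := by
      have hs : component s φ = component s ψ := by
        fin_cases s
        · exact congrArg Prod.fst h
        · exact congrArg Prod.snd h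
      exact congrArg (fun g : GSp4 R => ((g : GL (Fin 4) R) : Matrix (Fin 4) (Fin 4) R)) hs
    have hc (c : Coord) : toPoint φ c = toPoint ψ c := by
      cases c with
      | a s i j => exact congrFun (congrFun (hA s) i) j
      | t s =>
        have h1 := toPoint_spec φ s
        rw [hA s] at h1
        exact similitude_unique h1 (toPoint_spec ψ s)
    apply Ideal.Quotient.algHom_ext
    ext c
    exact hc c
  · rintro ⟨⟨γ, ν, hν⟩, ⟨δ, μ, hμ⟩⟩
    let g : Fin 2 → Matrix (Fin 4) (Fin 4) R := ![γ, δ]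
    let u : Fin 2 → R := ![((ν⁻¹ : Rˣ) : R), ((μ⁻¹ : Rˣ) : R)]
    let x : Coord → R := fun c => match c with
      | Coord.a s i j => g s i j
      | Coord.t s => u s
    have hx (s : Fin 2) : x (Coord.t s) • ((evalMatrix x s)ᵀ * J R * evalMatrix x s) = J R := by
      fin_cases s
      · change ((ν⁻¹ : Rˣ) : R) • ((γ : Matrix (Fin 4) (Fin 4) R)ᵀ * J R *
          (γ : Matrix (Fin 4) (Fin 4) R)) = J R
        rw [hν, smul_smul, Units.inv_mul, one_smul]
      · change ((μ⁻¹ : Rˣ) : R) • ((δ : Matrix (Fin 4) (Fin 4) R)ᵀ * J R *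
          (δ : Matrix (Fin 4) (Fin 4) R)) = J R
        rw [hμ, smul_smul, Units.inv_mul, one_smul]
    refine ⟨Ideal.Quotient.liftₐ (relationIdeal K) (MvPolynomial.aeval x) ?_, ?_⟩
    · intro f hf
      have hle : relationIdeal K ≤ RingHom.ker (MvPolynomial.aeval x : _ →ₐ[K] R) := by
        rw [relationIdeal, Ideal.span_le]
        rintro _ ⟨s, i, l, hil, rfl⟩
        change MvPolynomial.aeval x (relation K s i l) = 0
        rw [aeval_relation]
        exact (upper_iff _ _).mpr (hx s) i l hil
      exact hle hf
    · refine Prod.ext ?_ ?_ <;> refine Subtype.ext (Units.ext (Matrix.ext fun i j => ?_)) <;>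
        rw [component_apply] <;>
        exact MvPolynomial.aeval_X x _

end Points

end GSpFour

/-! ### Domains and prime elements on a principal open cover -/

section Cover

variable {A ι : Type*} [CommRing A] (m : ι → A)

/-! The argument is Nagata's criterion, carried out over an arbitrary base `B` so that it can be
iterated.

Let `A` be the universal similitude over `B`. The entries of its first column generate the unit
ideal, so four principal opens cover `GSp₄`. Where the entry `i` of that column is a unit, an
explicit symplectic matrix (`frame`) has the same first column. Dividing by it on the left leaves a
similitude fixing the first basis vector, and these are parametrised by seven free entries, four of
which form an invertible 2 × 2 block. Hence each chart ring is a polynomial ring in 11 variables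
over `B`, localised at one element (`GSpRing.locEquivChart`).

If `B` is a domain, so are the charts, and they glue to a domain. The corner entry of `A` is a
variable on every chart other than its own and divides none of the other entries there, so it is
prime globally (`GSpRing.prime_mat_zero_zero`). Inverting it gives a localised polynomial ring,
which is factorial when `B` is; Nagata's criterion then shows that `GSpRing B` is factorial for
every Noetherian factorial `B`.

The coordinate ring of the product is `GSpRing (GSpRing K)` (`coordinateRingEquiv`), so two
applications suffice. -/

theorem isDomain_of_isDomain_localizationAway [Nontrivial A]
    (hspan : Ideal.span (Set.range m) = ⊤)
    (hdom : ∀ i, IsDomain (Localization.Away (m i)))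
    (hne : ∀ i j, algebraMap A (Localization.Away (m i)) (m j) ≠ 0) : IsDomain A := by
  -- The ring embeds in each chart: if `x` dies on chart `i`, a power of `m i` kills it. That power
  -- is nonzero in the domain of any chart `j`, so `x` dies on every chart.
  have key (i : ι) (x : A) (hx : algebraMap A (Localization.Away (m i)) x = 0) : x = 0 := by
    have hmem : x ∈ (⊥ : Ideal A) := by
      refine Submodule.mem_of_span_eq_top_of_smul_pow_mem _ _ hspan x ?_
      rintro ⟨_, j, rfl⟩
      have := hdom j
      obtain ⟨n, hn⟩ := IsLocalization.Away.exists_of_eq (m i) (hx.trans (map_zero _).symm)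
      have hj := congrArg (algebraMap A (Localization.Away (m j))) hn
      rw [mul_zero, map_zero, map_mul, map_pow] at hj
      have hj' := (mul_eq_zero.mp hj).resolve_left (pow_ne_zero n (hne j i))
      obtain ⟨k, hk⟩ := IsLocalization.Away.exists_of_eq (m j) (hj'.trans (map_zero _).symm)
      exact ⟨k, by simpa using hk⟩
    simpa using hmem
  have hι : Nonempty ι := by
    by_contra h
    rw [not_nonempty_iff] at h
    rw [Set.range_eq_empty, Ideal.span_empty] at hspan
    exact bot_ne_top hspan
  obtain ⟨i⟩ := hι
  have := hdom i
  exact ((injective_iff_map_eq_zero _).mpr (key i)).isDomain (algebraMap A _)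

/-- Divisibility by `m i₀` on one chart `i ≠ i₀` already gives divisibility in `A`. Clearing
denominators gives `m i₀ ∣ m i ^ n * x`; on another chart `m i₀` is prime and does not divide `m i`,
so it divides `x`. Primality therefore descends from a single chart. -/
theorem prime_of_prime_localizationAway [IsDomain A] [Nontrivial ι]
    (hspan : Ideal.span (Set.range m) = ⊤) (i₀ : ι) (hne : m i₀ ≠ 0)
    (hprime : ∀ i ≠ i₀, Prime (algebraMap A (Localization.Away (m i)) (m i₀)))
    (hndvd : ∀ i ≠ i₀, ∀ j ≠ i₀, ¬ algebraMap A (Localization.Away (m i)) (m i₀) ∣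
      algebraMap A (Localization.Away (m i)) (m j)) : Prime (m i₀) := by
  obtain ⟨i, hi⟩ := exists_ne i₀
  have exists_dvd (j : ι) (x : A) (hx : algebraMap A (Localization.Away (m j)) (m i₀) ∣
      algebraMap A (Localization.Away (m j)) x) : ∃ n : ℕ, m i₀ ∣ m j ^ n * x := by
    obtain ⟨z, hz⟩ := hx
    obtain ⟨n, a, ha⟩ := IsLocalization.Away.surj (m j) z
    obtain ⟨k, hk⟩ := IsLocalization.Away.exists_of_eq (S := Localization.Away (m j)) (m j)
      (a := m j ^ n * x) (b := m i₀ * a) (by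
        rw [map_mul, map_mul, hz, ← ha, map_pow]; ring)
    exact ⟨k + n, m j ^ k * a, by rw [pow_add, mul_assoc, hk]; ring⟩
  have key (x : A) (hx : algebraMap A (Localization.Away (m i)) (m i₀) ∣
      algebraMap A (Localization.Away (m i)) x) : m i₀ ∣ x := by
    rw [← Ideal.mem_span_singleton]
    refine Submodule.mem_of_span_eq_top_of_smul_pow_mem _ _ hspan x ?_
    rintro ⟨_, j, rfl⟩
    simp only [smul_eq_mul, Ideal.mem_span_singleton]
    -- On the chart of `m i₀` itself nothing is needed, since `m i₀` divides `m i₀ * x`.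
    by_cases hj : j = i₀
    · exact ⟨1, by simp [hj]⟩
    · refine exists_dvd j x ?_
      obtain ⟨n, hn⟩ := exists_dvd i x hx
      have h := map_dvd (algebraMap A (Localization.Away (m j))) hn
      rw [map_mul, map_pow] at h
      exact ((hprime j hj).dvd_or_dvd h).resolve_left
        fun h' => hndvd j hj i hi ((hprime j hj).dvd_of_dvd_pow h')
  refine ⟨hne, fun hu => (hprime i hi).not_isUnit (hu.map _), fun x y hxy => ?_⟩
  have h := map_dvd (algebraMap A (Localization.Away (m i))) hxy
  rw [map_mul] at h
  exact ((hprime i hi).dvd_or_dvd h).imp (key x) (key y)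

end Cover

namespace GSpFour

/-! ### Factoring a similitude as a frame times a stabiliser element -/

section Matrices

variable {R S : Type*} [CommRing R] [CommRing S]

/-- The relation `t Aᵀ J A = J` that defines `GSp₄`. -/
def IsSimilitude (A : Matrix (Fin 4) (Fin 4) R) (t : R) : Prop :=
  t • (Aᵀ * J R * A) = J R

theorem J_mul_J (R : Type*) [CommRing R] : J R * J R = -1 := by
  ext i j
  fin_cases i <;> fin_cases j <;> simp [J, Matrix.mul_apply, Fin.sum_univ_succ]

theorem IsSimilitude.map {A : Matrix (Fin 4) (Fin 4) R} {t : R} (h : IsSimilitude A t)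
    (f : R →+* S) : IsSimilitude (A.map f) (f t) := by
  have h1 := congrArg (fun B : Matrix (Fin 4) (Fin 4) R => B.map f) h
  simp only [Matrix.map_smul' _ _ _ (map_mul f), Matrix.map_mul, J_map] at h1
  exact h1

theorem IsSimilitude.mul {A B : Matrix (Fin 4) (Fin 4) R} {t u : R} (hA : IsSimilitude A t)
    (hB : IsSimilitude B u) : IsSimilitude (A * B) (t * u) := by
  calc (t * u) • ((A * B)ᵀ * J R * (A * B))
      = u • (Bᵀ * (t • (Aᵀ * J R * A)) * B) := by
        simp only [transpose_mul, Matrix.mul_assoc, Matrix.smul_mul, Matrix.mul_smul, smul_smul,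
          mul_comm u t]
    _ = J R := by rw [hA, hB]

/-- The inverse of a symplectic matrix. -/
def symplecticInv (A : Matrix (Fin 4) (Fin 4) R) : Matrix (Fin 4) (Fin 4) R :=
  -(J R * Aᵀ * J R)

/-- The inverse is given by a polynomial formula, so it commutes with every ring homomorphism
without a unit hypothesis. -/
theorem symplecticInv_map (A : Matrix (Fin 4) (Fin 4) R) (f : R →+* S) :
    (symplecticInv A).map f = symplecticInv (A.map f) := by
  have h : (J R * Aᵀ * J R).map f = J S * (A.map f)ᵀ * J S := by
    rw [Matrix.map_mul, Matrix.map_mul, J_map, Matrix.transpose_map]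
  rw [symplecticInv, symplecticInv, ← h]
  ext i j
  exact map_neg f _

theorem symplecticInv_mul {A : Matrix (Fin 4) (Fin 4) R} (h : IsSimilitude A 1) :
    symplecticInv A * A = 1 := by
  rw [IsSimilitude, one_smul] at h
  rw [symplecticInv, Matrix.neg_mul, Matrix.mul_assoc, Matrix.mul_assoc, ← Matrix.mul_assoc Aᵀ, h,
    J_mul_J, neg_neg]

theorem mul_symplecticInv {A : Matrix (Fin 4) (Fin 4) R} (h : IsSimilitude A 1) :
    A * symplecticInv A = 1 :=
  mul_eq_one_comm.mp (symplecticInv_mul h)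

theorem isSimilitude_symplecticInv {A : Matrix (Fin 4) (Fin 4) R} (h : IsSimilitude A 1) :
    IsSimilitude (symplecticInv A) 1 := by
  have h1 := mul_symplecticInv h
  have h2 : (symplecticInv A)ᵀ * Aᵀ = 1 := by rw [← transpose_mul, h1, transpose_one]
  rw [IsSimilitude, one_smul] at h ⊢
  calc (symplecticInv A)ᵀ * J R * symplecticInv A
      = ((symplecticInv A)ᵀ * Aᵀ) * J R * (A * symplecticInv A) := by
        conv_lhs => rw [← h]
        simp only [Matrix.mul_assoc]
    _ = J R := by rw [h1, h2, Matrix.one_mul, Matrix.mul_one]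

/-- A symplectic matrix with first column `x`, provided that `u` is inverse to `x i`. -/
def frame (i : Fin 4) (x : Fin 4 → R) (u : R) : Matrix (Fin 4) (Fin 4) R :=
  match i with
  | 0 => !![x 0, 0, 0, 0; x 1, 1, 0, 0; x 2, 0, 1, 0; x 3, x 2 * u, -(x 1 * u), u]
  | 1 => !![x 0, 1, 0, 0; x 1, 0, 0, 0; x 2, x 3 * u, -(x 0 * u), u; x 3, 0, 1, 0]
  | 2 => !![x 0, 1, 0, 0; x 1, -(x 3 * u), x 0 * u, -u; x 2, 0, 0, 0; x 3, 0, 1, 0]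
  | 3 => !![x 0, -(x 2 * u), x 1 * u, -u; x 1, 1, 0, 0; x 2, 0, 1, 0; x 3, 0, 0, 0]

theorem frame_map (i : Fin 4) (x : Fin 4 → R) (u : R) (f : R →+* S) :
    (frame i x u).map f = frame i (f ∘ x) (f u) := by
  ext j k
  fin_cases i <;> fin_cases j <;> fin_cases k <;> simp [frame]

theorem frame_apply_zero (i j : Fin 4) (x : Fin 4 → R) (u : R) : frame i x u j 0 = x j := by
  fin_cases i <;> fin_cases j <;> simp [frame]

/-- The last column is `± u` times the basis vector dual to the `i`-th one, so it pairs to 1 with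
`x`. The middle columns are the other two basis vectors, made orthogonal to `x` by adding multiples
of the last column. -/
theorem isSimilitude_frame {i : Fin 4} {x : Fin 4 → R} {u : R} (h : x i * u = 1) :
    IsSimilitude (frame i x u) 1 := by
  rw [IsSimilitude, ← upper_iff]
  intro j k hjk
  fin_cases i <;> fin_cases j <;> fin_cases k <;> simp at hjk <;>
    simp [frame, J, Matrix.mul_apply, Fin.sum_univ_succ] <;> simp at h <;> grind

/-- The multiplier of `stab y`. -/
def stabMultiplier (y : Fin 7 → R) : R := y 3 * y 6 - y 4 * y 5

/-- The similitudes that fix the first basis vector. -/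
def stab (y : Fin 7 → R) : Matrix (Fin 4) (Fin 4) R :=
  !![1, y 0, y 1, y 2;
     0, y 3, y 4, y 3 * y 1 - y 4 * y 0;
     0, y 5, y 6, y 5 * y 1 - y 6 * y 0;
     0, 0, 0, stabMultiplier y]

/-- The free entries of a similitude that fixes the first basis vector. -/
def stabCoord (A : Matrix (Fin 4) (Fin 4) R) : Fin 7 → R :=
  ![A 0 1, A 0 2, A 0 3, A 1 1, A 1 2, A 2 1, A 2 2]

theorem stabMultiplier_map (y : Fin 7 → R) (f : R →+* S) :
    f (stabMultiplier y) = stabMultiplier (f ∘ y) := by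
  simp [stabMultiplier]

theorem stab_map (y : Fin 7 → R) (f : R →+* S) : (stab y).map f = stab (f ∘ y) := by
  ext j k
  fin_cases j <;> fin_cases k <;> simp [stab, stabMultiplier]

theorem stabCoord_map (A : Matrix (Fin 4) (Fin 4) R) (f : R →+* S) :
    f ∘ stabCoord A = stabCoord (A.map f) := by
  ext j
  fin_cases j <;> simp [stabCoord]

theorem stabCoord_stab (y : Fin 7 → R) : stabCoord (stab y) = y := by
  ext j
  fin_cases j <;> simp [stabCoord, stab]

theorem stab_apply_zero (y : Fin 7 → R) (j : Fin 4) :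
    stab y j 0 = (1 : Matrix (Fin 4) (Fin 4) R) j 0 := by
  fin_cases j <;> simp [stab, Matrix.one_apply]

theorem isSimilitude_stab {y : Fin 7 → R} {t : R} (h : stabMultiplier y * t = 1) :
    IsSimilitude (stab y) t := by
  rw [IsSimilitude, ← upper_iff]
  intro j k hjk
  fin_cases j <;> fin_cases k <;> simp at hjk <;>
    simp [stab, J, Matrix.mul_apply, Fin.sum_univ_succ] <;> rw [stabMultiplier] at * <;> grind

/-- Pairing the first column with columns 1 and 2 kills the bottom entries of these two. The
relations (0,3) and (1,2) equate the corner entry with the determinant of the middle block, and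
(1,3) and (2,3) form a linear system for the middle of the last column. -/
theorem IsSimilitude.stabCoord_spec {A : Matrix (Fin 4) (Fin 4) R} {t : R} (h : IsSimilitude A t)
    (hA : ∀ j, A j 0 = (1 : Matrix (Fin 4) (Fin 4) R) j 0) :
    stab (stabCoord A) = A ∧ stabMultiplier (stabCoord A) * t = 1 := by
  have hu := (isUnit_of_eq h).1
  have h0 := hA 0
  have h1 := hA 1
  have h2 := hA 2
  have h3 := hA 3
  have h01 := congrFun (congrFun h 0) 1
  have h02 := congrFun (congrFun h 0) 2
  have h03 := congrFun (congrFun h 0) 3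
  have h12 := congrFun (congrFun h 1) 2
  have h13 := congrFun (congrFun h 1) 3
  have h23 := congrFun (congrFun h 2) 3
  simp at h0 h1 h2 h3
  simp [J, Matrix.mul_apply, Fin.sum_univ_succ, h0, h1, h2, h3] at h01 h02 h03 h12 h13 h23
  rw [hu.mul_right_eq_zero] at h01 h02 h13 h23
  rw [h01] at h12 h13
  rw [h02] at h12 h23
  have hν : A 1 1 * A 2 2 - A 1 2 * A 2 1 = A 3 3 := by
    apply hu.mul_left_cancel
    linear_combination h12 - h03
  refine ⟨?_, ?_⟩
  · ext j k
    fin_cases j <;> fin_cases k <;>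
      simp [stab, stabCoord, stabMultiplier, h0, h1, h2, h3, h01, h02, hν]
    -- The entries (1,3) and (2,3) remain; the determinant of their linear system has inverse `t`.
    · apply hu.mul_left_cancel
      grind
    · apply hu.mul_left_cancel
      grind
  · simp [stabCoord, stabMultiplier]
    linear_combination h12

end Matrices


/-! ### The coordinate ring of `GSp₄` over a base and its universal property -/

/-- The generic `4 × 4` matrix. -/
noncomputable def genMat (B : Type*) [CommRing B] :
    Matrix (Fin 4) (Fin 4) (MvPolynomial (Option (Fin 4 × Fin 4)) B) :=
  Matrix.of fun i j => MvPolynomial.X (some (i, j))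

/-- The matrix `t Aᵀ J A - J`, where `A` is the generic matrix and `t` is the variable `none`. -/
noncomputable def relationMat (B : Type*) [CommRing B] :
    Matrix (Fin 4) (Fin 4) (MvPolynomial (Option (Fin 4 × Fin 4)) B) :=
  (MvPolynomial.X none : MvPolynomial (Option (Fin 4 × Fin 4)) B) •
    ((genMat B)ᵀ * J _ * genMat B) - J _

/-- The coordinate ring of `GSp₄` over `B`; the variable `none` is the inverse multiplier. -/
abbrev GSpRing (B : Type*) [CommRing B] : Type _ :=
  MvPolynomial (Option (Fin 4 × Fin 4)) B ⧸
    Ideal.span {f : MvPolynomial (Option (Fin 4 × Fin 4)) B | ∃ i l : Fin 4, f = relationMat B i l}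

namespace GSpRing

variable (B : Type*) [CommRing B]

/-- The universal similitude. -/
noncomputable def mat : Matrix (Fin 4) (Fin 4) (GSpRing B) :=
  (genMat B).map (Ideal.Quotient.mk _)

/-- The inverse of the multiplier of the universal similitude. -/
noncomputable def invMultiplier : GSpRing B := Ideal.Quotient.mk _ (MvPolynomial.X none)

theorem isSimilitude_mat : IsSimilitude (mat B) (invMultiplier B) := by
  rw [IsSimilitude, mat, invMultiplier, ← J_map (Ideal.Quotient.mk _), ← Matrix.transpose_map,
    ← Matrix.map_mul, ← Matrix.map_mul, ← Matrix.map_smul' _ _ _ (map_mul _)]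
  ext i l
  simp only [Matrix.map_apply]
  rw [Ideal.Quotient.eq]
  exact Ideal.subset_span ⟨i, l, rfl⟩

variable {B} {C : Type*} [CommRing C]

/-- The ring homomorphism given by a similitude. -/
noncomputable def lift (f : B →+* C) {A : Matrix (Fin 4) (Fin 4) C} {t : C}
    (h : IsSimilitude A t) : GSpRing B →+* C :=
  Ideal.Quotient.lift _
    (MvPolynomial.eval₂Hom f fun c => c.elim t fun p => A p.1 p.2) <| by
    intro a ha
    rw [← RingHom.mem_ker]
    refine Ideal.span_le.mpr ?_ ha
    rintro _ ⟨i, l, rfl⟩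
    rw [SetLike.mem_coe, RingHom.mem_ker, ← Matrix.map_apply (f := MvPolynomial.eval₂Hom f _),
      relationMat, Matrix.map_sub _ (map_sub _), Matrix.map_smul' _ _ _ (map_mul _), Matrix.map_mul,
      Matrix.map_mul, J_map, Matrix.transpose_map]
    have hA : (genMat B).map
        (MvPolynomial.eval₂Hom f fun c => c.elim t fun p => A p.1 p.2) = A := by
      ext i j
      simp [genMat]
    rw [hA]
    have ht : (MvPolynomial.eval₂Hom f fun c => c.elim t fun p => A p.1 p.2)
        (MvPolynomial.X none : MvPolynomial (Option (Fin 4 × Fin 4)) B) = t := by simp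
    rw [ht, h, sub_self, Matrix.zero_apply]

variable (f : B →+* C) {A : Matrix (Fin 4) (Fin 4) C} {t : C} (h : IsSimilitude A t)

@[simp]
theorem lift_algebraMap (b : B) : lift f h (algebraMap B _ b) = f b :=
  (Ideal.Quotient.lift_mk _ _ _).trans (MvPolynomial.eval₂Hom_C _ _ _)

@[simp]
theorem lift_mat (i j : Fin 4) : lift f h (mat B i j) = A i j :=
  (Ideal.Quotient.lift_mk _ _ _).trans (MvPolynomial.eval₂Hom_X' _ _ _)

theorem mat_map_lift : (mat B).map (lift f h) = A := by
  ext i j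
  simp

@[simp]
theorem lift_invMultiplier : lift f h (invMultiplier B) = t :=
  (Ideal.Quotient.lift_mk _ _ _).trans (MvPolynomial.eval₂Hom_X' _ _ _)

/-- The inverse multiplier needs no check of its own, being determined by the matrix. -/
theorem ringHom_ext {f g : GSpRing B →+* C}
    (hB : ∀ b, f (algebraMap B _ b) = g (algebraMap B _ b))
    (hA : (mat B).map f = (mat B).map g) : f = g := by
  have ht : f (invMultiplier B) = g (invMultiplier B) := by
    refine similitude_unique (A := (mat B).map f) ((isSimilitude_mat B).map f) ?_
    rw [hA]
    exact (isSimilitude_mat B).map g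
  refine Ideal.Quotient.ringHom_ext (MvPolynomial.ringHom_ext (fun b => hB b) ?_)
  rintro (_ | ⟨i, j⟩)
  · exact ht
  · exact congrFun (congrFun hA i) j

end GSpRing

/-! ### The charts as localised polynomial rings -/

/-- The coordinates of the chart of `GSp₄` on which a given entry of the first column is a unit,
before inverting anything. -/
abbrev ChartPoly (B : Type*) [CommRing B] : Type _ := MvPolynomial (Fin 4 ⊕ Fin 7) B

/-- The function that is inverted in the `i`-th chart. -/
noncomputable def chartUnit (B : Type*) [CommRing B] (i : Fin 4) : ChartPoly B :=
  MvPolynomial.X (Sum.inl i) * stabMultiplier fun k => MvPolynomial.X (Sum.inr k)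

/-- The coordinate ring of the open subset of `GSp₄` on which the `i`-th entry of the first column
is a unit. -/
abbrev ChartRing (B : Type*) [CommRing B] (i : Fin 4) : Type _ :=
  Localization.Away (chartUnit B i)

namespace ChartRing

variable (B : Type*) [CommRing B] (i : Fin 4)

/-- The first column of the universal similitude on the chart. -/
noncomputable def col (j : Fin 4) : ChartRing B i :=
  algebraMap (ChartPoly B) _ (MvPolynomial.X (Sum.inl j))

/-- The coordinates of the stabilizer part of the universal similitude on the chart. -/
noncomputable def coord (k : Fin 7) : ChartRing B i :=
  algebraMap (ChartPoly B) _ (MvPolynomial.X (Sum.inr k))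

theorem isUnit_mul : IsUnit (col B i i * stabMultiplier (coord B i)) := by
  have h : IsUnit (algebraMap (ChartPoly B) (ChartRing B i)
      (MvPolynomial.X (Sum.inl i) * stabMultiplier fun k => MvPolynomial.X (Sum.inr k))) :=
    IsLocalization.Away.algebraMap_isUnit (chartUnit B i)
  rwa [map_mul, stabMultiplier_map] at h

theorem isUnit_col : IsUnit (col B i i) := isUnit_of_mul_isUnit_left (isUnit_mul B i)

theorem isUnit_stabMultiplier : IsUnit (stabMultiplier (coord B i)) :=
  isUnit_of_mul_isUnit_right (isUnit_mul B i)

/-- The symplectic part of the universal similitude on the chart. -/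
noncomputable def frameMat : Matrix (Fin 4) (Fin 4) (ChartRing B i) :=
  frame i (col B i) (Ring.inverse (col B i i))

theorem isSimilitude_frameMat : IsSimilitude (frameMat B i) 1 :=
  isSimilitude_frame (Ring.mul_inverse_cancel _ (isUnit_col B i))

theorem isSimilitude_frame_mul_stab : IsSimilitude (frameMat B i * stab (coord B i))
    (Ring.inverse (stabMultiplier (coord B i))) := by
  have h := (isSimilitude_frameMat B i).mul (isSimilitude_stab
    (Ring.mul_inverse_cancel _ (isUnit_stabMultiplier B i)))
  rwa [one_mul] at h

theorem frame_mul_stab_apply_zero (j : Fin 4) :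
    (frameMat B i * stab (coord B i)) j 0 = col B i j := by
  rw [Matrix.mul_apply]
  simp only [stab_apply_zero]
  rw [← Matrix.mul_apply, Matrix.mul_one, frameMat, frame_apply_zero]

variable {B i} {C : Type*} [CommRing C]

/-- The ring homomorphism given by a point of the chart. -/
noncomputable def lift (f : B →+* C) {x : Fin 4 → C} {y : Fin 7 → C} (hx : IsUnit (x i))
    (hy : IsUnit (stabMultiplier y)) : ChartRing B i →+* C :=
  IsLocalization.Away.lift (chartUnit B i) (g := MvPolynomial.eval₂Hom f (Sum.elim x y)) <| by
    rw [chartUnit, map_mul, stabMultiplier_map]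
    have : (MvPolynomial.eval₂Hom f (Sum.elim x y)) ∘
        (fun k => MvPolynomial.X (Sum.inr k)) = y := by
      ext k
      simp
    rw [this]
    simpa using hx.mul hy

variable (f : B →+* C) {x : Fin 4 → C} {y : Fin 7 → C} (hx : IsUnit (x i))
    (hy : IsUnit (stabMultiplier y))

@[simp]
theorem lift_algebraMap (b : B) : lift f hx hy (algebraMap B _ b) = f b := by
  rw [IsScalarTower.algebraMap_apply B (ChartPoly B), lift, IsLocalization.Away.lift_eq]
  exact MvPolynomial.eval₂Hom_C _ _ _

@[simp]
theorem lift_col (j : Fin 4) : lift f hx hy (col B i j) = x j := by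
  rw [col, lift, IsLocalization.Away.lift_eq]
  simp

@[simp]
theorem lift_coord (k : Fin 7) : lift f hx hy (coord B i k) = y k := by
  rw [coord, lift, IsLocalization.Away.lift_eq]
  simp

theorem ringHom_ext {f g : ChartRing B i →+* C}
    (hB : ∀ b, f (algebraMap B _ b) = g (algebraMap B _ b))
    (hx : ∀ j, f (col B i j) = g (col B i j)) (hy : ∀ k, f (coord B i k) = g (coord B i k)) :
    f = g := by
  refine IsLocalization.ringHom_ext (Submonoid.powers (chartUnit B i))
    (MvPolynomial.ringHom_ext (fun b => ?_) ?_)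
  · have := hB b
    rwa [IsScalarTower.algebraMap_apply B (ChartPoly B)] at this
  · rintro (j | k)
    · exact hx j
    · exact hy k

/-- A `B`-point of the chart on which only the `j`-th column entry vanishes; evaluating there
refutes divisibility by `col B i j`. -/
theorem exists_lift_eq [IsDomain B] (j : Fin 4) (hj : j ≠ i) :
    ∃ g : ChartRing B i →+* B, g (col B i j) = 0 ∧ ∀ k ≠ j, g (col B i k) = 1 := by
  -- These seven coordinates are those of the identity matrix, with multiplier 1.
  refine ⟨lift (RingHom.id B) (x := fun k => if k = j then 0 else 1) (y := ![0, 0, 0, 1, 0, 0, 1])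
    ?_ ?_, ?_, ?_⟩
  · simp [hj.symm]
  · simp [stabMultiplier]
  · simp
  · intro k hk
    simp [hk]

theorem chartUnit_ne_zero [IsDomain B] (i : Fin 4) : chartUnit B i ≠ 0 := by
  intro h
  have h1 := congrArg (MvPolynomial.eval (Sum.elim (fun _ => (1 : B)) ![0, 0, 0, 1, 0, 0, 1])) h
  simp [chartUnit, stabMultiplier] at h1

instance [IsDomain B] : IsDomain (ChartRing B i) :=
  IsLocalization.Away.isDomain (ChartRing B i) (chartUnit_ne_zero (B := B) i)

theorem col_ne_zero [IsDomain B] (j : Fin 4) : col B i j ≠ 0 := by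
  intro h
  have h1 := congrArg (lift (RingHom.id B) (x := fun _ => 1) (y := ![0, 0, 0, 1, 0, 0, 1])
    (by simp) (by simp [stabMultiplier])) h
  simp at h1

theorem not_dvd_col [IsDomain B] {j k : Fin 4} (hj : j ≠ i) (hk : k ≠ j) :
    ¬ col B i j ∣ col B i k := by
  intro h
  obtain ⟨g, hg0, hg1⟩ := exists_lift_eq (B := B) j hj
  have h1 := map_dvd g h
  rw [hg0, hg1 k hk, zero_dvd_iff] at h1
  exact one_ne_zero h1

/-- A variable is prime in the polynomial ring, and it stays prime after localisation because it
does not divide the inverted element: at the point of `exists_lift_eq` it vanishes while that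
element maps to a unit. -/
theorem prime_col [IsDomain B] {j : Fin 4} (hj : j ≠ i) : Prime (col B i j) := by
  have hprime : (Ideal.span {(MvPolynomial.X (Sum.inl j) : ChartPoly B)}).IsPrime :=
    (Ideal.span_singleton_prime (MvPolynomial.X_ne_zero _)).mpr MvPolynomial.X_prime
  have hdisj : Disjoint (Submonoid.powers (chartUnit B i) : Set (ChartPoly B))
      (Ideal.span {(MvPolynomial.X (Sum.inl j) : ChartPoly B)}) := by
    rw [Ideal.disjoint_powers_iff_notMem_of_isPrime, Ideal.mem_span_singleton]
    intro h
    obtain ⟨g, hg0, hg1⟩ := exists_lift_eq (B := B) j hj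
    have h1 := map_dvd (algebraMap _ (ChartRing B i)) h
    have h2 := map_dvd g (isUnit_iff_dvd_one.mp (isUnit_of_dvd_unit h1
      (IsLocalization.Away.algebraMap_isUnit _)))
    change g (col B i j) ∣ _ at h2
    simp [hg0] at h2
  have h := IsLocalization.isPrime_of_isPrime_disjoint (Submonoid.powers (chartUnit B i))
    (ChartRing B i) _ hprime hdisj
  rw [Ideal.map_span, Set.image_singleton] at h
  exact (Ideal.span_singleton_prime (col_ne_zero j)).mp h

end ChartRing

/-! ### Gluing the charts, and Nagata's criterion -/

namespace GSpRing

variable (B : Type*) [CommRing B] (i : Fin 4)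

/-- The restriction to the `i`-th chart. -/
noncomputable def toChart : GSpRing B →+* ChartRing B i :=
  lift (algebraMap B _) (ChartRing.isSimilitude_frame_mul_stab B i)

theorem toChart_mat_zero (j : Fin 4) : toChart B i (mat B j 0) = ChartRing.col B i j := by
  rw [toChart, lift_mat, ChartRing.frame_mul_stab_apply_zero]

/-- The part of the ring where an entry of the first column is inverted. -/
abbrev LocRing : Type _ := Localization.Away (mat B i 0)

/-- The map from the localization to the chart. -/
noncomputable def locToChart : LocRing B i →+* ChartRing B i :=
  IsLocalization.Away.lift (mat B i 0) (g := toChart B i) <| by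
    rw [toChart_mat_zero]
    exact ChartRing.isUnit_col B i

theorem locToChart_algebraMap (a : GSpRing B) :
    locToChart B i (algebraMap _ _ a) = toChart B i a :=
  IsLocalization.Away.lift_eq _ _ _

/-- The universal similitude over the localization. -/
noncomputable def locMat : Matrix (Fin 4) (Fin 4) (LocRing B i) :=
  (mat B).map (algebraMap _ _)

theorem isUnit_locMat : IsUnit (locMat B i i 0) :=
  IsLocalization.Away.algebraMap_isUnit (S := LocRing B i) (mat B i 0)

/-- A symplectic matrix with the same first column as the universal similitude. -/
noncomputable def locFrame : Matrix (Fin 4) (Fin 4) (LocRing B i) :=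
  frame i (fun j => locMat B i j 0) (Ring.inverse (locMat B i i 0))

theorem isSimilitude_locFrame : IsSimilitude (locFrame B i) 1 :=
  isSimilitude_frame (Ring.mul_inverse_cancel _ (isUnit_locMat B i))

/-- The stabilizer part of the universal similitude. -/
noncomputable def locStab : Matrix (Fin 4) (Fin 4) (LocRing B i) :=
  symplecticInv (locFrame B i) * locMat B i

theorem isSimilitude_locStab :
    IsSimilitude (locStab B i) (algebraMap _ (LocRing B i) (invMultiplier B)) := by
  have h := (isSimilitude_symplecticInv (isSimilitude_locFrame B i)).mul
    ((isSimilitude_mat B).map (algebraMap _ (LocRing B i)))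
  rwa [one_mul] at h

theorem locStab_apply_zero (j : Fin 4) :
    locStab B i j 0 = (1 : Matrix (Fin 4) (Fin 4) (LocRing B i)) j 0 := by
  have h (k : Fin 4) : locMat B i k 0 = locFrame B i k 0 := by rw [locFrame, frame_apply_zero]
  rw [locStab, Matrix.mul_apply]
  simp only [h]
  rw [← Matrix.mul_apply, symplecticInv_mul (isSimilitude_locFrame B i)]

theorem stab_stabCoord_locStab : stab (stabCoord (locStab B i)) = locStab B i :=
  ((isSimilitude_locStab B i).stabCoord_spec (locStab_apply_zero B i)).1

theorem isUnit_stabMultiplier_locStab : IsUnit (stabMultiplier (stabCoord (locStab B i))) :=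
  IsUnit.of_mul_eq_one _ ((isSimilitude_locStab B i).stabCoord_spec (locStab_apply_zero B i)).2

/-- The map from the chart to the localization. -/
noncomputable def chartToLoc : ChartRing B i →+* LocRing B i :=
  ChartRing.lift (algebraMap B _) (x := fun j => locMat B i j 0) (y := stabCoord (locStab B i))
    (isUnit_locMat B i) (isUnit_stabMultiplier_locStab B i)

theorem map_inverse {R S : Type*} [CommRing R] [CommRing S] (f : R →+* S) {a : R}
    (ha : IsUnit a) : f (Ring.inverse a) = Ring.inverse (f a) := by
  apply (ha.map f).mul_left_cancel
  rw [← map_mul, Ring.mul_inverse_cancel _ ha, Ring.mul_inverse_cancel _ (ha.map f), map_one]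

theorem frameMat_map_chartToLoc :
    (ChartRing.frameMat B i).map (chartToLoc B i) = locFrame B i := by
  rw [ChartRing.frameMat, frame_map, map_inverse _ (ChartRing.isUnit_col B i), locFrame]
  congr 1
  · ext j
    simp [chartToLoc]
  · simp [chartToLoc]

theorem locMat_map_locToChart : (locMat B i).map (locToChart B i) =
    ChartRing.frameMat B i * stab (ChartRing.coord B i) := by
  ext j k
  rw [Matrix.map_apply, locMat, Matrix.map_apply, locToChart_algebraMap, toChart, lift_mat]

theorem locFrame_map_locToChart :
    (locFrame B i).map (locToChart B i) = ChartRing.frameMat B i := by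
  have h (j : Fin 4) : locToChart B i (locMat B i j 0) = ChartRing.col B i j := by
    rw [← Matrix.map_apply (f := locToChart B i), locMat_map_locToChart,
      ChartRing.frame_mul_stab_apply_zero]
  rw [ChartRing.frameMat, locFrame, frame_map, map_inverse _ (isUnit_locMat B i), h]
  congr 1
  ext j
  simp [h]

/-- The localization at an entry of the first column is the ring of the corresponding chart. -/
noncomputable def locEquivChart : LocRing B i ≃+* ChartRing B i :=
  RingEquiv.ofRingHom (locToChart B i) (chartToLoc B i)
    (by
      refine ChartRing.ringHom_ext (fun b => ?_) (fun j => ?_) (fun k => ?_)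
      · simp only [RingHom.comp_apply, RingHom.id_apply, chartToLoc, ChartRing.lift_algebraMap]
        rw [IsScalarTower.algebraMap_apply B (GSpRing B), locToChart_algebraMap, toChart,
          lift_algebraMap]
      · simp only [RingHom.comp_apply, RingHom.id_apply, chartToLoc, ChartRing.lift_col]
        rw [← Matrix.map_apply (f := locToChart B i), locMat_map_locToChart,
          ChartRing.frame_mul_stab_apply_zero]
      -- Removing the frame from the product frame times stabiliser returns the stabiliser part,
      -- whose coordinates are the given ones.
      · simp only [RingHom.comp_apply, RingHom.id_apply, chartToLoc, ChartRing.lift_coord]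
        rw [← Function.comp_apply (f := locToChart B i), stabCoord_map, locStab, Matrix.map_mul,
          symplecticInv_map, locFrame_map_locToChart, locMat_map_locToChart, ← Matrix.mul_assoc,
          symplecticInv_mul (ChartRing.isSimilitude_frameMat B i), Matrix.one_mul,
          stabCoord_stab])
    (by
      refine IsLocalization.ringHom_ext (Submonoid.powers (mat B i 0))
        (ringHom_ext (fun b => ?_) ?_)
      · simp only [RingHom.comp_apply, RingHom.id_apply, locToChart_algebraMap, toChart,
          lift_algebraMap, chartToLoc, ChartRing.lift_algebraMap]
        rw [IsScalarTower.algebraMap_apply B (GSpRing B)]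
      · have h : (mat B).map (((chartToLoc B i).comp (locToChart B i)).comp (algebraMap _ _)) =
            ((mat B).map (toChart B i)).map (chartToLoc B i) := by
          ext j k
          simp [locToChart_algebraMap]
        have hy : chartToLoc B i ∘ ChartRing.coord B i = stabCoord (locStab B i) := by
          ext k
          simp [chartToLoc]
        -- The frame times its inverse times the universal matrix is the universal matrix again.
        rw [h, toChart, mat_map_lift, Matrix.map_mul, frameMat_map_chartToLoc, stab_map, hy,
          stab_stabCoord_locStab, locStab, ← Matrix.mul_assoc,
          mul_symplecticInv (isSimilitude_locFrame B i), Matrix.one_mul]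
        rfl)

theorem locEquivChart_mat_zero (j : Fin 4) :
    locEquivChart B i (algebraMap _ _ (mat B j 0)) = ChartRing.col B i j := by
  change locToChart B i _ = _
  rw [locToChart_algebraMap, toChart_mat_zero]

/-- The (0,3) entry of `t Aᵀ J A = J` writes 1 as a linear combination of the first column. -/
theorem span_mat_zero : Ideal.span (Set.range fun i => mat B i 0) = ⊤ := by
  rw [Ideal.eq_top_iff_one]
  have h := congrFun (congrFun (isSimilitude_mat B) 0) 3
  have hm (j : Fin 4) : mat B j 0 ∈ Ideal.span (Set.range fun i => mat B i 0) :=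
    Ideal.subset_span ⟨j, rfl⟩
  have h1 : invMultiplier B * ∑ j, mat B j 0 * ∑ k, J (GSpRing B) j k * mat B k 3 = 1 := by
    rw [Matrix.mul_assoc, Matrix.smul_apply, Matrix.mul_apply] at h
    simpa [Matrix.mul_apply, J] using h
  rw [← h1]
  exact Ideal.mul_mem_left _ _ (Ideal.sum_mem _ fun j _ => Ideal.mul_mem_right _ _ (hm j))

variable [IsDomain B]

instance : Nontrivial (GSpRing B) := (toChart B 0).domain_nontrivial

instance isDomain : IsDomain (GSpRing B) :=
  isDomain_of_isDomain_localizationAway (fun i => mat B i 0) (span_mat_zero B)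
    (fun i => (locEquivChart B i).toMulEquiv.isDomain _) fun i j h => by
      have h1 := congrArg (locEquivChart B i) h
      rw [locEquivChart_mat_zero, map_zero] at h1
      exact ChartRing.col_ne_zero j h1

theorem prime_mat_zero_zero : Prime (mat B 0 0) := by
  refine prime_of_prime_localizationAway (fun i => mat B i 0) (span_mat_zero B) 0 ?_ ?_ ?_
  · intro h
    have h1 := congrArg (toChart B 0) h
    rw [toChart_mat_zero, map_zero] at h1
    exact ChartRing.col_ne_zero 0 h1
  · intro i hi
    rw [← MulEquiv.prime_iff (locEquivChart B i), locEquivChart_mat_zero]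
    exact ChartRing.prime_col hi.symm
  · intro i hi j hj h
    have h1 := map_dvd (locEquivChart B i) h
    rw [locEquivChart_mat_zero, locEquivChart_mat_zero] at h1
    exact ChartRing.not_dvd_col hi.symm hj h1

/-- Nagata's criterion at the corner entry: it is prime, and inverting it gives chart 0, a
localisation of a polynomial ring over the factorial ring `B`. -/
instance uniqueFactorizationMonoid [IsNoetherianRing B] [UniqueFactorizationMonoid B] :
    UniqueFactorizationMonoid (GSpRing B) := by
  rw [UniqueFactorizationMonoid.iff_localizationAway_of_prime (prime_mat_zero_zero B)]
  exact (locEquivChart B 0).symm.toMulEquiv.uniqueFactorizationMonoid inferInstance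

end GSpRing

/-! ### The product as an iterated coordinate ring -/

section Product

variable (K : Type*) [CommRing K]

/-- The universal similitude on the factor `s`. -/
noncomputable def universalMatrix (s : Fin 2) : Matrix (Fin 4) (Fin 4) (CoordinateRing K) :=
  (genericMatrix K s).map (Ideal.Quotient.mk _)

theorem isSimilitude_universalMatrix (s : Fin 2) : IsSimilitude (universalMatrix K s)
    (Ideal.Quotient.mk (relationIdeal K) (MvPolynomial.X (Coord.t s))) :=
  toPoint_spec (AlgHom.id K (CoordinateRing K)) s

/-- The similitude over `GSpRing (GSpRing K)` that corresponds to the factor `s`. -/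
noncomputable def iteratedMatrix (s : Fin 2) :
    Matrix (Fin 4) (Fin 4) (GSpRing (GSpRing K)) :=
  ![(GSpRing.mat K).map (algebraMap _ _), GSpRing.mat (GSpRing K)] s

/-- The inverse of the multiplier of `iteratedMatrix K s`. -/
noncomputable def iteratedInvMultiplier (s : Fin 2) : GSpRing (GSpRing K) :=
  ![algebraMap _ _ (GSpRing.invMultiplier K), GSpRing.invMultiplier (GSpRing K)] s

theorem isSimilitude_iteratedMatrix (s : Fin 2) :
    IsSimilitude (iteratedMatrix K s) (iteratedInvMultiplier K s) := by
  fin_cases s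
  · exact (GSpRing.isSimilitude_mat K).map _
  · exact GSpRing.isSimilitude_mat (GSpRing K)

/-- The point of the ambient affine space given by the two similitudes. -/
noncomputable def iteratedPoint : Coord → GSpRing (GSpRing K)
  | Coord.a s i j => iteratedMatrix K s i j
  | Coord.t s => iteratedInvMultiplier K s

/-- The map from the coordinate ring of the product to the iterated coordinate ring. -/
noncomputable def toIterated : CoordinateRing K →ₐ[K] GSpRing (GSpRing K) :=
  Ideal.Quotient.liftₐ (relationIdeal K) (MvPolynomial.aeval (iteratedPoint K)) <| by
    intro f hf
    rw [← RingHom.mem_ker]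
    refine Ideal.span_le.mpr ?_ hf
    rintro _ ⟨s, i, l, hil, rfl⟩
    rw [SetLike.mem_coe, RingHom.mem_ker, aeval_relation]
    -- `CoordinateRing` imposes only the entries above the diagonal, `GSpRing` all of them;
    -- `upper_iff` reconciles the two.
    exact (upper_iff _ _).mpr (isSimilitude_iteratedMatrix K s) i l hil

theorem toIterated_X (c : Coord) :
    toIterated K (Ideal.Quotient.mk _ (MvPolynomial.X c)) = iteratedPoint K c :=
  MvPolynomial.aeval_X _ c

/-- The map from the iterated coordinate ring to the coordinate ring of the product. -/
noncomputable def ofIterated : GSpRing (GSpRing K) →+* CoordinateRing K :=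
  GSpRing.lift (GSpRing.lift (algebraMap K _) (isSimilitude_universalMatrix K 0))
    (isSimilitude_universalMatrix K 1)

/-- The coordinate ring of `GSp₄ × GSp₄` is the coordinate ring of `GSp₄` over that of `GSp₄`. -/
noncomputable def coordinateRingEquiv : CoordinateRing K ≃+* GSpRing (GSpRing K) :=
  RingEquiv.ofRingHom (toIterated K).toRingHom (ofIterated K)
    (by
      refine GSpRing.ringHom_ext (fun a => ?_) ?_
      · refine RingHom.congr_fun (f := (((toIterated K).toRingHom.comp
          (ofIterated K)).comp (algebraMap _ _))) (g := algebraMap _ _)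
          (GSpRing.ringHom_ext (fun b => ?_) ?_) a
        · simp only [RingHom.comp_apply, ofIterated, GSpRing.lift_algebraMap]
          rw [← IsScalarTower.algebraMap_apply]
          exact (toIterated K).commutes b
        · ext i j
          simp only [Matrix.map_apply, RingHom.comp_apply, ofIterated, GSpRing.lift_algebraMap,
            GSpRing.lift_mat]
          exact toIterated_X K _
      · ext i j
        simp only [Matrix.map_apply, RingHom.comp_apply, ofIterated, GSpRing.lift_mat]
        exact toIterated_X K _)
    (by
      refine Ideal.Quotient.ringHom_ext (MvPolynomial.ringHom_ext (fun b => ?_) ?_)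
      · change ofIterated K (toIterated K (algebraMap K _ b)) = algebraMap K _ b
        rw [AlgHom.commutes, IsScalarTower.algebraMap_apply K (GSpRing K), ofIterated,
          GSpRing.lift_algebraMap, GSpRing.lift_algebraMap]
      · intro c
        change ofIterated K (toIterated K (Ideal.Quotient.mk _ (MvPolynomial.X c))) =
          Ideal.Quotient.mk _ (MvPolynomial.X c)
        rw [toIterated_X, ofIterated]
        rcases c with ⟨s, i, j⟩ | s <;> fin_cases s <;>
          simp [iteratedPoint, iteratedMatrix, iteratedInvMultiplier] <;> rfl)

end Product

end GSpFour

theorem mainTheorem12 :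
    IsDomain (GSpFour.CoordinateRing (AlgebraicClosure ℚ)) ∧
      UniqueFactorizationMonoid (GSpFour.CoordinateRing (AlgebraicClosure ℚ)) := by
  have e := GSpFour.coordinateRingEquiv (AlgebraicClosure ℚ)
  -- Instance search applies the one-factor result twice, starting from the field, which is
  -- Noetherian and factorial.
  exact ⟨e.toMulEquiv.isDomain _, e.symm.toMulEquiv.uniqueFactorizationMonoid inferInstance⟩
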